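/- Let $N\ge 1$ and $\sigma>0$, let $\mathbf X$ be a random vector in $\mathbb R^N$ whose law is rotationally invariant (invariant under every orthogonal transformation of $\mathbb R^N$), and let $\rho$ be the law of $\|\mathbf X\|$. Let $\mathbf N$ be independent of $\mathbf X$ and normally distributed in $\mathbb R^N$ with mean $0$ and covariance matrix $\sigma^2 \mathrm{Id}$, and let $\mathbf Y=\mathbf X+\mathbf N$. Define $$f_{\tilde R}(\tilde r)=\int_{[0,\infty)} \chi\!\left(\tilde r,\frac{s}{\sigma}\right)\,\rho(\mathrm ds),\qquad \chi(\tilde r,\tilde s)=\frac{\tilde r^{N/2}}{\tilde s^{N/2-1}}\exp\!\left(-\frac{\tilde r^2+\tilde s^2}{2}\right)I_{N/2-1}(\tilde r\tilde s),$$ where $I_\nu(u)=\sum_{k\ge 0}\frac{(u/2)^{2k+\nu}}{k!\,\Gamma(k+\nu+1)}$ is the modified Bessel function of the first kind and $\chi(\tilde r,0)=\frac{\tilde r^{N-1}e^{-\tilde r^2/2}}{2^{N/2-1}\Gamma(N/2)}$ is the limit of $\chi(\tilde r,\tilde s)$ as $\tilde s\downarrow 0$. If $\rho$ has a density $f_{\|\mathbf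 X\|}$, then $f_{\tilde R}(\tilde r)=\int_0^\infty f_{\|\mathbf X\|}(s)\,\chi(\tilde r,s/\sigma)\,\mathrm ds$. Then $f_{\tilde R}$ is the probability density of $\tilde R=\|\mathbf Y\|/\sigma$ on $(0,\infty)$, and the mutual information of $\mathbf X$ and $\mathbf Y$ in bits (the relative entropy to base $2$ of the joint law of $(\mathbf X,\mathbf Y)$ from the product of its marginals), which equals the difference of differential entropies $h(\mathbf Y)-h(\mathbf N)$ in bits, is $$I(\mathbf X;\mathbf Y)=-\int_0^\infty f_{\tilde R}(\tilde r)\log_2\frac{f_{\tilde R}(\tilde r)}{\tilde r^{N-1}}\,\mathrm d\tilde r+\log_2\frac{2}{\Gamma(N/2)}-\frac N2\log_2(2e).$$ The positive part of the integrand $f_{\tilde R}\log_2(f_{\tilde R}/\tilde r^{N-1})$ always has a finite integral, so the right-hand side is well defined in $(-\infty,\infty]$, and the equality holds also when both sides are $+\infty$. -/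

import Mathlib

open MeasureTheory ProbabilityTheory Set
open scoped ENNReal

noncomputable section

namespace RotInv

/-- The modified Bessel function of the first kind of real order `ν`, at a real argument `u ≥ 0`:
`I_ν(u) = ∑_k (u/2)^(2k+ν) / (k! Γ(k+ν+1))`.  (Mathlib's `Gamma` vanishes at the poles, which
together with `x / 0 = 0` gives the usual convention `1/Γ = 0` there.) -/
def besselI (ν u : ℝ) : ℝ :=
  ∑' k : ℕ, (u / 2) ^ (2 * (k : ℝ) + ν) / ((k.factorial : ℝ) * Real.Gamma ((k : ℝ) + ν + 1))

/-- The normalized noncentral chi density with `N` degrees of freedom,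
`χ(r, s) = r^(N/2) / s^(N/2-1) * exp (-(r² + s²)/2) * I_{N/2-1}(r s)`.
At `s = 0`, where the quotient is to be read as its limit for `s ↓ 0`, it is the (central) chi
density `r^(N-1) exp (-r²/2) / (2^(N/2-1) Γ(N/2))`. -/
def chiDensity (N : ℕ) (r s : ℝ) : ℝ :=
  if s = 0 then
    r ^ (N - 1) * Real.exp (-r ^ 2 / 2) / (2 ^ ((N : ℝ) / 2 - 1) * Real.Gamma ((N : ℝ) / 2))
  else
    r ^ ((N : ℝ) / 2) / s ^ ((N : ℝ) / 2 - 1) * Real.exp (-(r ^ 2 + s ^ 2) / 2)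
      * besselI ((N : ℝ) / 2 - 1) (r * s)

/-- The mixture `r ↦ ∫ χ(r, s/σ) dρ(s)` of noncentral chi densities, for an arbitrary law `ρ` of
the input radius (which may have a density, be discrete, or neither). -/
def radialMixture (N : ℕ) (σ : ℝ) (ρ : Measure ℝ) (r : ℝ) : ℝ :=
  ∫ s, chiDensity N r (s / σ) ∂ρ

/-- The integral of a real function as an extended real number: the integral of the positive part
minus the integral of the negative part.  It is meaningful as soon as one of the two is finite. -/
def extIntegral {α : Type*} [MeasurableSpace α] (μ : Measure α) (g : α → ℝ) : EReal :=
  ((∫⁻ x, ENNReal.ofReal (g x) ∂μ : ℝ≥0∞) : EReal)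
    - ((∫⁻ x, ENNReal.ofReal (-g x) ∂μ : ℝ≥0∞) : EReal)

/-- The differential entropy `-∫ f log₂ f`, in bits, of a law on `ℝ^N` with Lebesgue density `f`. -/
def diffEntropy {N : ℕ} (ρ : Measure (EuclideanSpace ℝ (Fin N))) : EReal :=
  -extIntegral volume fun y =>
    (ρ.rnDeriv volume y).toReal * Real.logb 2 (ρ.rnDeriv volume y).toReal

/-- The mutual information, in bits, of two random variables on `(Ω, P)`: the Kullback-Leibler
divergence of their joint law from the product of their laws, with logarithms to base 2. -/
def mutualInfo {Ω α β : Type*} [MeasurableSpace Ω] [MeasurableSpace α] [MeasurableSpace β]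
    (P : Measure Ω) (X : Ω → α) (Y : Ω → β) : ℝ≥0∞ :=
  InformationTheory.klDiv (P.map fun ω => (X ω, Y ω)) ((P.map X).prod (P.map Y))
    / ENNReal.ofReal (Real.log 2)

/-- A law on `ℝ^N` is rotationally invariant if every orthogonal transformation preserves it. -/
def RotationallyInvariant {N : ℕ} (ρ : Measure (EuclideanSpace ℝ (Fin N))) : Prop :=
  ∀ A : EuclideanSpace ℝ (Fin N) ≃ₗᵢ[ℝ] EuclideanSpace ℝ (Fin N), ρ.map A = ρ

/-- The expression
`-∫₀^∞ f(r) log₂ (f(r) / r^(N-1)) dr + log₂ (2 / Γ(N/2)) - (N/2) log₂ (2e)`. -/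
def radialRate (N : ℕ) (f : ℝ → ℝ) : EReal :=
  -extIntegral (volume.restrict (Ioi 0)) (fun r => f r * Real.logb 2 (f r / r ^ (N - 1)))
    + ((Real.logb 2 (2 / Real.Gamma ((N : ℝ) / 2))
        - (N : ℝ) / 2 * Real.logb 2 (2 * Real.exp 1) : ℝ) : EReal)

end RotInv

end

/-! Let `p` be the Lebesgue density of the output, the average of Gaussian densities centred at the
input. It is positive, bounded by the peak of the Gaussian, and inherits rotation invariance, so it
depends on the norm only. Relative to the product of the marginals, the joint law has density
`gaussDensity(y - x) / p(y)`. Its logarithm is `log gaussDensity(Z) - log p(Y)`, whose first term is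
always integrable; hence the divergence is `h(Y) - h(Z)`, and both are `+∞` exactly when `p log p`
is not integrable (`mutualInfo_eq`).

The Bessel function enters through `lintegral_mul_exp_inner`. Expanding the square in the Gaussian
leaves the integral of `exp ⟨x, w⟩` against a rotationally invariant weight. By symmetry this is a
sum of even moments of `⟨x, w⟩`, and these are found by averaging over a Gaussian direction instead
of integrating over a sphere. The resulting series is that of `I_{N/2-1}`, so the chi mixture at `r`
is the sphere area times `σ^N r^(N-1) p` at radius `σ r` (`radialMixture_eq`).

Polar coordinates then identify the mixture as the density of the normalized radius and turn `∫ p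
log p` into the radial integral; the remaining constants add up to `-h(Z)` (`radialRate_eq`).
Identities are first proved in `[0, ∞]`, so that Tonelli applies without integrability assumptions.
-/

noncomputable section

namespace RotInv

open Module

/-! ### Polar coordinates. -/

/-- Integration of a radial function in polar coordinates. -/
lemma lintegral_fun_norm_eq {V : Type*} [NormedAddCommGroup V] [NormedSpace ℝ V]
    [MeasurableSpace V] [BorelSpace V] [Nontrivial V] [FiniteDimensional ℝ V]
    (μ : Measure V) [μ.IsAddHaarMeasure] {f : ℝ → ℝ≥0∞} (hf : Measurable f) :
    ∫⁻ x, f ‖x‖ ∂μ = finrank ℝ V * μ (Metric.ball 0 1)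
      * ∫⁻ t in Ioi (0 : ℝ), ENNReal.ofReal (t ^ (finrank ℝ V - 1)) * f t := by
  calc
    ∫⁻ x, f ‖x‖ ∂μ = ∫⁻ x : ({(0)}ᶜ : Set V), f ‖x.1‖ ∂(μ.comap (↑)) := by
      rw [lintegral_subtype_comap (measurableSet_singleton _).compl fun x ↦ f ‖x‖,
        restrict_compl_singleton]
    _ = ∫⁻ x, f x.2 ∂μ.toSphere.prod (.volumeIoiPow (finrank ℝ V - 1)) := by
      simpa using μ.measurePreserving_homeomorphUnitSphereProd.lintegral_comp_emb
        (Homeomorph.measurableEmbedding _) (f ∘ Subtype.val ∘ Prod.snd)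
    _ = μ.toSphere univ * ∫⁻ x : Ioi (0 : ℝ), f x ∂.volumeIoiPow (finrank ℝ V - 1) := by
      rw [lintegral_prod _ (by fun_prop)]
      simp [mul_comm]
    _ = _ := by
      rw [Measure.volumeIoiPow, lintegral_withDensity_eq_lintegral_mul _ (by fun_prop)
        (by fun_prop), μ.toSphere_apply_univ, ← lintegral_subtype_comap measurableSet_Ioi]
      rfl

/-- The surface area of the unit sphere of `ℝ^N`. -/
def sphereArea (N : ℕ) : ℝ := 2 * Real.pi ^ ((N : ℝ) / 2) / Real.Gamma ((N : ℝ) / 2)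

lemma sphereArea_pos {N : ℕ} (hN : 1 ≤ N) : 0 < sphereArea N := by
  have : (0 : ℝ) < N := by exact_mod_cast hN
  have := Real.Gamma_pos_of_pos (show 0 < (N : ℝ) / 2 by positivity)
  unfold sphereArea
  positivity

lemma natCast_mul_volume_ball {N : ℕ} (hN : 1 ≤ N) :
    (N : ℝ≥0∞) * volume (Metric.ball (0 : EuclideanSpace ℝ (Fin N)) 1)
      = ENNReal.ofReal (sphereArea N) := by
  have : Nonempty (Fin N) := ⟨⟨0, hN⟩⟩
  have hN0 : (0 : ℝ) < N := by exact_mod_cast hN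
  have hG := Real.Gamma_pos_of_pos (show 0 < (N : ℝ) / 2 by positivity)
  rw [EuclideanSpace.volume_ball, ← ENNReal.ofReal_natCast]
  simp only [ENNReal.ofReal_one, one_pow, one_mul, Fintype.card_fin]
  rw [← ENNReal.ofReal_mul hN0.le, Real.Gamma_add_one (by positivity), sphereArea,
    Real.sqrt_eq_rpow, ← Real.rpow_natCast, ← Real.rpow_mul Real.pi_pos.le]
  congr 1
  rw [show 1 / 2 * (N : ℝ) = N / 2 by ring]
  field_simp

/-- Integration in polar coordinates on `ℝ^N`, with the radius measured in units of `σ`. -/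
lemma lintegral_fun_norm_div {N : ℕ} (hN : 1 ≤ N) {σ : ℝ} (hσ : 0 < σ) {f : ℝ → ℝ≥0∞}
    (hf : Measurable f) :
    ∫⁻ x : EuclideanSpace ℝ (Fin N), f (‖x‖ / σ)
      = ENNReal.ofReal (sphereArea N * σ ^ N)
        * ∫⁻ t in Ioi (0 : ℝ), ENNReal.ofReal (t ^ (N - 1)) * f t := by
  have : Nonempty (Fin N) := ⟨⟨0, hN⟩⟩
  have h1 : ∫⁻ x : EuclideanSpace ℝ (Fin N), f (‖x‖ / σ)
      = ∫⁻ x, f ‖x‖ ∂((volume : Measure (EuclideanSpace ℝ (Fin N))).map (fun x => σ⁻¹ • x)) := by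
    rw [lintegral_map (by fun_prop) (by fun_prop)]
    refine lintegral_congr fun x => ?_
    rw [norm_smul, norm_inv, Real.norm_of_nonneg hσ.le, div_eq_inv_mul]
  rw [h1, Measure.map_addHaar_smul _ (by positivity), lintegral_smul_measure,
    lintegral_fun_norm_eq _ hf, finrank_euclideanSpace_fin, natCast_mul_volume_ball hN,
    smul_eq_mul, ← mul_assoc, ← ENNReal.ofReal_mul (by positivity)]
  congr 2
  rw [inv_pow, inv_inv, abs_of_pos (by positivity), mul_comm]

lemma lintegral_norm_pow_mul_exp {N : ℕ} (hN : 1 ≤ N) {b : ℝ} (hb : 0 < b) (k : ℕ) :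
    ∫⁻ x : EuclideanSpace ℝ (Fin N), ENNReal.ofReal (‖x‖ ^ (2 * k) * Real.exp (-b * ‖x‖ ^ 2))
      = ENNReal.ofReal (sphereArea N / 2 * b ^ (-((N : ℝ) / 2 + k))
          * Real.Gamma ((N : ℝ) / 2 + k)) := by
  have hq : (-1 : ℝ) < (N : ℝ) - 1 + 2 * k := by
    have : (1 : ℝ) ≤ N := by exact_mod_cast hN
    have : (0 : ℝ) ≤ k := by positivity
    linarith
  have h := lintegral_fun_norm_div hN one_pos
    (f := fun r => ENNReal.ofReal (r ^ (2 * k) * Real.exp (-b * r ^ 2))) (by fun_prop)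
  simp only [div_one, one_pow, mul_one] at h
  rw [h]
  have h2 : ∫⁻ t in Ioi (0 : ℝ), ENNReal.ofReal (t ^ (N - 1))
        * ENNReal.ofReal (t ^ (2 * k) * Real.exp (-b * t ^ 2))
      = ∫⁻ t in Ioi (0 : ℝ), ENNReal.ofReal
          (t ^ ((N : ℝ) - 1 + 2 * k) * Real.exp (-b * t ^ (2 : ℝ))) := by
    refine setLIntegral_congr_fun measurableSet_Ioi fun t (ht : 0 < t) => ?_
    rw [← ENNReal.ofReal_mul (by positivity), ← mul_assoc, ← pow_add, ← Real.rpow_natCast,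
      Real.rpow_two]
    push_cast [Nat.cast_sub hN]
    rfl
  rw [h2, ← ofReal_integral_eq_lintegral_ofReal, integral_rpow_mul_exp_neg_mul_rpow two_pos hq hb,
    ← ENNReal.ofReal_mul (sphereArea_pos hN).le]
  · rw [show ((N : ℝ) - 1 + 2 * k + 1) / 2 = N / 2 + k by ring,
      show -((N : ℝ) - 1 + 2 * k + 1) / 2 = -((N : ℝ) / 2 + k) by ring]
    congr 1
    ring
  · exact integrableOn_rpow_mul_exp_neg_mul_rpow hq two_pos hb
  · filter_upwards [ae_restrict_mem measurableSet_Ioi] with t (ht : 0 < t)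
    positivity

/-! ### Gaussian densities and moments. -/

/-- The density of the centred normal law on `ℝ^N` with covariance `σ² Id`. -/
def gaussDensity (N : ℕ) (σ : ℝ) (x : EuclideanSpace ℝ (Fin N)) : ℝ :=
  (2 * Real.pi * σ ^ 2) ^ (-(N : ℝ) / 2) * Real.exp (-‖x‖ ^ 2 / (2 * σ ^ 2))

lemma gaussDensity_pos {N : ℕ} {σ : ℝ} (hσ : 0 < σ) (x : EuclideanSpace ℝ (Fin N)) :
    0 < gaussDensity N σ x := by
  have := Real.pi_pos
  unfold gaussDensity
  positivity

@[fun_prop]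
lemma continuous_gaussDensity {N : ℕ} {σ : ℝ} : Continuous (gaussDensity N σ) := by
  unfold gaussDensity
  fun_prop

lemma gaussDensity_le {N : ℕ} {σ : ℝ} (hσ : 0 < σ) (x : EuclideanSpace ℝ (Fin N)) :
    gaussDensity N σ x ≤ (2 * Real.pi * σ ^ 2) ^ (-(N : ℝ) / 2) := by
  have := Real.pi_pos
  refine mul_le_of_le_one_right (by positivity) (Real.exp_le_one_iff.2 ?_)
  rw [neg_div]
  exact neg_nonpos.2 (by positivity)

lemma lintegral_norm_pow_mul_gaussDensity {N : ℕ} (hN : 1 ≤ N) {σ : ℝ} (hσ : 0 < σ) (k : ℕ) :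
    ∫⁻ x : EuclideanSpace ℝ (Fin N), ENNReal.ofReal (‖x‖ ^ (2 * k) * gaussDensity N σ x)
      = ENNReal.ofReal ((2 * σ ^ 2) ^ k * Real.Gamma ((N : ℝ) / 2 + k)
          / Real.Gamma ((N : ℝ) / 2)) := by
  have hpi := Real.pi_pos
  have hN0 : (0 : ℝ) < N := by exact_mod_cast hN
  have hG := Real.Gamma_pos_of_pos (show 0 < (N : ℝ) / 2 by positivity)
  have hc : 0 ≤ (2 * Real.pi * σ ^ 2) ^ (-(N : ℝ) / 2) := by positivity
  have h1 : ∀ x : EuclideanSpace ℝ (Fin N),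
      ENNReal.ofReal (‖x‖ ^ (2 * k) * gaussDensity N σ x)
        = ENNReal.ofReal ((2 * Real.pi * σ ^ 2) ^ (-(N : ℝ) / 2))
          * ENNReal.ofReal (‖x‖ ^ (2 * k) * Real.exp (-(1 / (2 * σ ^ 2)) * ‖x‖ ^ 2)) := by
    intro x
    rw [← ENNReal.ofReal_mul hc, gaussDensity,
      show -(1 / (2 * σ ^ 2)) * ‖x‖ ^ 2 = -‖x‖ ^ 2 / (2 * σ ^ 2) by ring]
    congr 1
    ring
  simp_rw [h1]
  rw [lintegral_const_mul _ (by fun_prop), lintegral_norm_pow_mul_exp hN (by positivity),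
    ← ENNReal.ofReal_mul hc]
  congr 1
  have e1 : (2 * Real.pi * σ ^ 2) ^ (-(N : ℝ) / 2)
      = (2 * σ ^ 2) ^ (-((N : ℝ) / 2)) * Real.pi ^ (-((N : ℝ) / 2)) := by
    rw [← Real.mul_rpow (by positivity) (by positivity)]
    congr 1 <;> ring
  have e2 : (1 / (2 * σ ^ 2)) ^ (-((N : ℝ) / 2 + k))
      = (2 * σ ^ 2) ^ ((N : ℝ) / 2) * (2 * σ ^ 2) ^ k := by
    rw [one_div, Real.inv_rpow (by positivity), Real.rpow_neg (by positivity), inv_inv,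
      Real.rpow_add (by positivity), Real.rpow_natCast]
  rw [e1, e2, sphereArea, Real.rpow_neg (by positivity), Real.rpow_neg (by positivity)]
  have := Real.rpow_pos_of_pos (show 0 < 2 * σ ^ 2 by positivity) ((N : ℝ) / 2)
  have := Real.rpow_pos_of_pos hpi ((N : ℝ) / 2)
  field_simp

lemma lintegral_gaussDensity {N : ℕ} (hN : 1 ≤ N) {σ : ℝ} (hσ : 0 < σ) :
    ∫⁻ x : EuclideanSpace ℝ (Fin N), ENNReal.ofReal (gaussDensity N σ x) = 1 := by
  have hN0 : (0 : ℝ) < N := by exact_mod_cast hN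
  have hG := Real.Gamma_pos_of_pos (show 0 < (N : ℝ) / 2 by positivity)
  simpa [hG.ne'] using lintegral_norm_pow_mul_gaussDensity hN hσ 0

/-- The law `N(0, σ² Id)` has density `gaussDensity N σ`. -/
lemma multivariateGaussian_eq_withDensity {N : ℕ} (hN : 1 ≤ N) {σ : ℝ} (hσ : 0 < σ) :
    multivariateGaussian 0 (σ ^ 2 • (1 : Matrix (Fin N) (Fin N) ℝ))
      = volume.withDensity fun x => ENNReal.ofReal (gaussDensity N σ x) := by
  have hpi := Real.pi_pos
  have : IsFiniteMeasure ((volume : Measure (EuclideanSpace ℝ (Fin N))).withDensity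
      fun x => ENNReal.ofReal (gaussDensity N σ x)) :=
    isFiniteMeasure_withDensity (by simp [lintegral_gaussDensity hN hσ])
  refine Measure.ext_of_charFun ?_
  ext t
  rw [charFun_multivariateGaussian (Matrix.PosSemidef.one.smul (sq_nonneg σ)), charFun_apply,
    integral_withDensity_eq_integral_toReal_smul (by fun_prop) (by simp)]
  have hb : 0 < ((1 / (2 * σ ^ 2) : ℝ) : ℂ).re := by
    rw [Complex.ofReal_re]; positivity
  have h1 : ∀ x : EuclideanSpace ℝ (Fin N),
      (ENNReal.ofReal (gaussDensity N σ x)).toReal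
          • Complex.exp ((inner ℝ x t : ℝ) * Complex.I)
        = (((2 * Real.pi * σ ^ 2) ^ (-(N : ℝ) / 2) : ℝ) : ℂ)
          * Complex.exp (-((1 / (2 * σ ^ 2) : ℝ) : ℂ) * (‖x‖ : ℂ) ^ 2
              + Complex.I * (inner ℝ t x : ℝ)) := by
    intro x
    rw [ENNReal.toReal_ofReal (gaussDensity_pos hσ x).le, gaussDensity, Complex.real_smul,
      Complex.ofReal_mul, mul_assoc, Complex.ofReal_exp, ← Complex.exp_add, real_inner_comm]
    congr 2
    push_cast
    ring
  simp_rw [h1]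
  rw [integral_const_mul, GaussianFourier.integral_cexp_neg_mul_sq_norm_add hb,
    finrank_euclideanSpace_fin, ← mul_assoc]
  -- The normalizing constant cancels the factor `(π / b)^(N/2)` of the Gaussian integral with `b =
  -- 1 / (2σ²)`.
  have h2 : (((2 * Real.pi * σ ^ 2) ^ (-(N : ℝ) / 2) : ℝ) : ℂ)
      * ((Real.pi : ℂ) / ((1 / (2 * σ ^ 2) : ℝ) : ℂ)) ^ ((N : ℂ) / 2) = 1 := by
    rw [← Complex.ofReal_div, show (N : ℂ) / 2 = ((N / 2 : ℝ) : ℂ) by push_cast; rfl,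
      ← Complex.ofReal_cpow (by positivity), ← Complex.ofReal_mul]
    rw [show Real.pi / (1 / (2 * σ ^ 2)) = 2 * Real.pi * σ ^ 2 by field_simp,
      ← Real.rpow_add (by positivity), show -(N : ℝ) / 2 + N / 2 = 0 by ring, Real.rpow_zero]
    simp
  rw [h2, one_mul]
  congr 1
  have h3 : t.ofLp ⬝ᵥ (σ ^ 2 • (1 : Matrix (Fin N) (Fin N) ℝ)).mulVec t.ofLp
      = σ ^ 2 * ‖t‖ ^ 2 := by
    rw [Matrix.smul_mulVec, Matrix.one_mulVec, dotProduct_smul, EuclideanSpace.real_norm_sq_eq]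
    simp [dotProduct, sq]
  have hs : (σ : ℂ) ≠ 0 := by exact_mod_cast hσ.ne'
  rw [inner_zero_right, h3, Complex.I_sq]
  push_cast
  field_simp
  ring

lemma stdGaussian_eq_withDensity {N : ℕ} (hN : 1 ≤ N) :
    stdGaussian (EuclideanSpace ℝ (Fin N))
      = volume.withDensity fun x => ENNReal.ofReal (gaussDensity N 1 x) := by
  rw [← multivariateGaussian_eq_withDensity hN one_pos]
  simp

lemma lintegral_norm_pow_stdGaussian {N : ℕ} (hN : 1 ≤ N) (k : ℕ) :
    ∫⁻ y, ENNReal.ofReal (‖y‖ ^ (2 * k)) ∂stdGaussian (EuclideanSpace ℝ (Fin N))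
      = ENNReal.ofReal (2 ^ k * Real.Gamma ((N : ℝ) / 2 + k) / Real.Gamma ((N : ℝ) / 2)) := by
  rw [stdGaussian_eq_withDensity hN, lintegral_withDensity_eq_lintegral_mul _ (by fun_prop)
    (by fun_prop)]
  have h := lintegral_norm_pow_mul_gaussDensity hN one_pos k
  simp only [one_pow, mul_one] at h
  rw [← h]
  refine lintegral_congr fun x => ?_
  rw [Pi.mul_apply, mul_comm, ← ENNReal.ofReal_mul (by positivity)]

lemma map_inner_stdGaussian {V : Type*} [NormedAddCommGroup V] [InnerProductSpace ℝ V]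
    [FiniteDimensional ℝ V] [MeasurableSpace V] [BorelSpace V] (x : V) :
    (stdGaussian V).map (fun y => inner ℝ x y) = (gaussianReal 0 1).map (fun t => ‖x‖ * t) := by
  have h := IsGaussian.map_eq_gaussianReal (μ := stdGaussian V) (innerSL ℝ x)
  rw [integral_strongDual_stdGaussian, variance_dual_stdGaussian, innerSL_apply_norm] at h
  rw [gaussianReal_map_const_mul, mul_zero, mul_one]
  convert h using 2
  · ext y
    simp
  · exact (Real.toNNReal_of_nonneg (sq_nonneg _)).symm

lemma lintegral_inner_pow_stdGaussian_eq_gaussianReal {V : Type*} [NormedAddCommGroup V]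
    [InnerProductSpace ℝ V] [FiniteDimensional ℝ V] [MeasurableSpace V] [BorelSpace V]
    (x : V) (k : ℕ) :
    ∫⁻ y, ENNReal.ofReal (inner ℝ x y ^ (2 * k)) ∂stdGaussian V
      = ENNReal.ofReal (‖x‖ ^ (2 * k))
        * ∫⁻ t, ENNReal.ofReal (t ^ (2 * k)) ∂gaussianReal 0 1 := by
  rw [← lintegral_const_mul _ (by fun_prop),
    ← lintegral_map (f := fun t : ℝ => ENNReal.ofReal (t ^ (2 * k))) (by fun_prop)
      (by fun_prop), map_inner_stdGaussian, lintegral_map (by fun_prop) (by fun_prop)]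
  refine lintegral_congr fun t => ?_
  rw [mul_pow, ENNReal.ofReal_mul (by positivity)]

/-- In dimension one the inner product with a unit vector is the norm up to sign, so this is the
norm moment formula at `N = 1`. -/
lemma lintegral_even_pow_gaussianReal (k : ℕ) :
    ∫⁻ t, ENNReal.ofReal (t ^ (2 * k)) ∂gaussianReal 0 1
      = ENNReal.ofReal (2 ^ k * Real.Gamma (1 / 2 + k) / √Real.pi) := by
  have h := lintegral_inner_pow_stdGaussian_eq_gaussianReal
    (EuclideanSpace.single (0 : Fin 1) (1 : ℝ)) k
  have h1 := lintegral_norm_pow_stdGaussian le_rfl k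
  rw [Nat.cast_one, Real.Gamma_one_half_eq] at h1
  simp only [PiLp.norm_single, norm_one, one_pow, ENNReal.ofReal_one, one_mul] at h
  rw [← h, ← h1]
  refine lintegral_congr fun y => ?_
  rw [pow_mul, pow_mul, EuclideanSpace.real_norm_sq_eq]
  simp [EuclideanSpace.inner_single_left]


/-! ### Rotational invariance and the noncentral chi kernel. -/

section Rotation

variable {N : ℕ} {μ : Measure (EuclideanSpace ℝ (Fin N))}

lemma RotationallyInvariant.lintegral_comp (hμ : RotationallyInvariant μ)
    (A : EuclideanSpace ℝ (Fin N) ≃ₗᵢ[ℝ] EuclideanSpace ℝ (Fin N))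
    {f : EuclideanSpace ℝ (Fin N) → ℝ≥0∞} (hf : Measurable f) :
    ∫⁻ x, f (A x) ∂μ = ∫⁻ x, f x ∂μ := by
  conv_rhs => rw [← hμ A, lintegral_map hf A.continuous.measurable]

/-- The reflection in the hyperplane orthogonal to `v - w` does it. -/
lemma exists_linearIsometryEquiv_apply_eq {V : Type*} [NormedAddCommGroup V]
    [InnerProductSpace ℝ V] {v w : V} (h : ‖v‖ = ‖w‖) : ∃ A : V ≃ₗᵢ[ℝ] V, A v = w :=
  ⟨_, Submodule.reflection_sub h⟩

lemma exists_norm_eq_one {N : ℕ} (hN : 1 ≤ N) : ∃ e : EuclideanSpace ℝ (Fin N), ‖e‖ = 1 :=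
  ⟨EuclideanSpace.single ⟨0, hN⟩ 1, by simp⟩

/-- The coefficients of `Γ(N/2) (2/u)^(N/2-1) I_{N/2-1}(u)` as a power series in `u²`. -/
def besselCoeff (N k : ℕ) : ℝ :=
  Real.Gamma ((N : ℝ) / 2) / (4 ^ k * k.factorial * Real.Gamma ((N : ℝ) / 2 + k))

lemma besselCoeff_pos {N : ℕ} (hN : 1 ≤ N) (k : ℕ) : 0 < besselCoeff N k := by
  have hN0 : (0 : ℝ) < N := by exact_mod_cast hN
  have := Real.Gamma_pos_of_pos (show 0 < (N : ℝ) / 2 by positivity)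
  have := Real.Gamma_pos_of_pos (show 0 < (N : ℝ) / 2 + k by positivity)
  unfold besselCoeff
  positivity

/-- Legendre's duplication formula at `k + 1/2`; it converts the one-dimensional Gaussian moments
into Bessel coefficients. -/
lemma factorial_two_mul_eq (k : ℕ) :
    ((2 * k).factorial : ℝ) = 4 ^ k * k.factorial * (Real.Gamma (1 / 2 + k) / √Real.pi) := by
  have h := Real.Gamma_mul_Gamma_add_half ((k : ℝ) + 1 / 2)
  have hpi : 0 < √Real.pi := Real.sqrt_pos.2 Real.pi_pos
  rw [show (k : ℝ) + 1 / 2 + 1 / 2 = k + 1 by ring, Real.Gamma_nat_eq_factorial,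
    show 2 * ((k : ℝ) + 1 / 2) = ((2 * k : ℕ) : ℝ) + 1 by push_cast; ring,
    Real.Gamma_nat_eq_factorial,
    show (1 : ℝ) - (((2 * k : ℕ) : ℝ) + 1) = -((2 * k : ℕ) : ℝ) by ring,
    Real.rpow_neg two_pos.le, Real.rpow_natCast, pow_mul] at h
  rw [add_comm (1 / 2 : ℝ)]
  norm_num at h ⊢
  field_simp at h ⊢
  linarith

/-- The even moments of the projections of a rotationally invariant law. -/
lemma RotationallyInvariant.lintegral_mul_inner_pow [SFinite μ] (hN : 1 ≤ N)
    (hμ : RotationallyInvariant μ) {H : ℝ → ℝ≥0∞} (hH : Measurable H)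
    (y : EuclideanSpace ℝ (Fin N)) (k : ℕ) :
    ∫⁻ x, H ‖x‖ * ENNReal.ofReal (inner ℝ x y ^ (2 * k)) ∂μ
      = ∫⁻ x, H ‖x‖
          * ENNReal.ofReal ((2 * k).factorial * (besselCoeff N k * (‖y‖ * ‖x‖) ^ (2 * k))) ∂μ := by
  obtain ⟨e, he⟩ := exists_norm_eq_one hN
  have hN0 : (0 : ℝ) < N := by exact_mod_cast hN
  have hG := Real.Gamma_pos_of_pos (show 0 < (N : ℝ) / 2 by positivity)
  have hGk := Real.Gamma_pos_of_pos (show 0 < (N : ℝ) / 2 + k by positivity)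
  set M : EuclideanSpace ℝ (Fin N) → ℝ≥0∞ :=
    fun y => ∫⁻ x, H ‖x‖ * ENNReal.ofReal (inner ℝ x y ^ (2 * k)) ∂μ with hM
  set W : ℝ≥0∞ := ∫⁻ x, H ‖x‖ * ENNReal.ofReal (‖x‖ ^ (2 * k)) ∂μ with hW
  -- Rotating `y` onto the axis of `e` leaves the single unknown `M e`, which averaging `M` over a
  -- standard Gaussian `y` determines: for fixed `x`, `⟨x, y⟩` is distributed as `‖x‖` times a
  -- standard normal variable.
  have hrad : ∀ y, M y = ENNReal.ofReal (‖y‖ ^ (2 * k)) * M e := by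
    intro y
    obtain ⟨A, hA⟩ := exists_linearIsometryEquiv_apply_eq
      (v := ‖y‖ • e) (w := y) (by simp [norm_smul, he])
    simp only [hM]
    rw [← hμ.lintegral_comp A (by fun_prop), ← lintegral_const_mul _ (by fun_prop)]
    refine lintegral_congr fun x => ?_
    nth_rw 1 [← hA]
    rw [LinearIsometryEquiv.norm_map, LinearIsometryEquiv.inner_map_map, inner_smul_right,
      mul_pow, ENNReal.ofReal_mul (by positivity)]
    ring
  have hint : ∫⁻ y, M y ∂stdGaussian (EuclideanSpace ℝ (Fin N))
      = ENNReal.ofReal (2 ^ k * Real.Gamma (1 / 2 + k) / √Real.pi) * W := by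
    simp only [hM]
    rw [lintegral_lintegral_swap (by fun_prop), hW, ← lintegral_const_mul _ (by fun_prop)]
    refine lintegral_congr fun x => ?_
    rw [lintegral_const_mul _ (by fun_prop), lintegral_inner_pow_stdGaussian_eq_gaussianReal,
      lintegral_even_pow_gaussianReal]
    ring
  rw [lintegral_congr hrad, lintegral_mul_const _ (by fun_prop), lintegral_norm_pow_stdGaussian hN] at hint
  have hMe : M e = ENNReal.ofReal ((2 * k).factorial * besselCoeff N k) * W := by
    have hC : 0 < 2 ^ k * Real.Gamma ((N : ℝ) / 2 + k) / Real.Gamma ((N : ℝ) / 2) := by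
      positivity
    -- The Gaussian norm moment is positive and finite, so it can be cancelled even if `M e` or `W`
    -- is infinite.
    have h := congrArg
      (fun z => ENNReal.ofReal (2 ^ k * Real.Gamma ((N : ℝ) / 2 + k)
        / Real.Gamma ((N : ℝ) / 2))⁻¹ * z) hint
    simp only [← mul_assoc, ← ENNReal.ofReal_mul (inv_nonneg.2 hC.le)] at h
    rw [inv_mul_cancel₀ hC.ne', ENNReal.ofReal_one, one_mul] at h
    rw [h]
    congr 2
    rw [factorial_two_mul_eq, besselCoeff]
    field_simp
  have hf : (0 : ℝ) ≤ (2 * k).factorial * besselCoeff N k :=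
    mul_nonneg (by positivity) (besselCoeff_pos hN k).le
  change M y = _
  rw [hrad, hMe, hW, ← mul_assoc, ← ENNReal.ofReal_mul (by positivity),
    ← lintegral_const_mul _ (by fun_prop)]
  refine lintegral_congr fun x => ?_
  rw [mul_left_comm, ← ENNReal.ofReal_mul (mul_nonneg (by positivity) hf)]
  congr 2
  ring

/-- The Laplace transform of a rotationally invariant law is a mixture of Bessel functions. -/
lemma RotationallyInvariant.lintegral_mul_exp_inner [SFinite μ] (hN : 1 ≤ N)
    (hμ : RotationallyInvariant μ) {H : ℝ → ℝ≥0∞} (hH : Measurable H)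
    (y : EuclideanSpace ℝ (Fin N)) :
    ∫⁻ x, H ‖x‖ * ENNReal.ofReal (Real.exp (inner ℝ x y)) ∂μ
      = ∫⁻ x, H ‖x‖ * ∑' k, ENNReal.ofReal (besselCoeff N k * (‖y‖ * ‖x‖) ^ (2 * k)) ∂μ := by
  have hcosh : ∀ x, ENNReal.ofReal (Real.cosh (inner ℝ x y))
      = ∑' k : ℕ, ENNReal.ofReal (((2 * k).factorial : ℝ)⁻¹)
          * ENNReal.ofReal (inner ℝ x y ^ (2 * k)) := by
    intro x
    have h := Real.hasSum_cosh (inner ℝ x y)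
    have h0 : ∀ k : ℕ, 0 ≤ inner ℝ x y ^ (2 * k) := fun k => by
      rw [pow_mul]; positivity
    rw [← h.tsum_eq, ENNReal.ofReal_tsum_of_nonneg (fun k => div_nonneg (h0 k) (by positivity))
      h.summable]
    refine tsum_congr fun k => ?_
    rw [← ENNReal.ofReal_mul (by positivity), div_eq_inv_mul]
  -- Invariance under `-Id` allows `exp` to be replaced by `cosh`, whose Taylor terms are
  -- nonnegative, so that sum and integral commute.
  have hneg : ∫⁻ x, H ‖x‖ * ENNReal.ofReal (Real.exp (-inner ℝ x y)) ∂μ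
      = ∫⁻ x, H ‖x‖ * ENNReal.ofReal (Real.exp (inner ℝ x y)) ∂μ := by
    rw [← hμ.lintegral_comp (LinearIsometryEquiv.neg ℝ) (by fun_prop)]
    simp
  have hsymm : ∫⁻ x, H ‖x‖ * ENNReal.ofReal (Real.exp (inner ℝ x y)) ∂μ
      = ∫⁻ x, H ‖x‖ * ENNReal.ofReal (Real.cosh (inner ℝ x y)) ∂μ := by
    have h1 : ∀ x, H ‖x‖ * ENNReal.ofReal (Real.cosh (inner ℝ x y))
        = ENNReal.ofReal (1 / 2) * (H ‖x‖ * ENNReal.ofReal (Real.exp (inner ℝ x y)))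
          + ENNReal.ofReal (1 / 2) * (H ‖x‖ * ENNReal.ofReal (Real.exp (-inner ℝ x y))) := by
      intro x
      rw [Real.cosh_eq, add_div, ENNReal.ofReal_add (by positivity) (by positivity),
        div_eq_inv_mul, div_eq_inv_mul, ENNReal.ofReal_mul (by positivity),
        ENNReal.ofReal_mul (by positivity), one_div]
      ring
    simp_rw [h1]
    rw [lintegral_add_left (by fun_prop), lintegral_const_mul _ (by fun_prop),
      lintegral_const_mul _ (by fun_prop), hneg, ← add_mul,
      ← ENNReal.ofReal_add (by norm_num) (by norm_num)]
    norm_num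
  rw [hsymm]
  simp_rw [hcosh, ← ENNReal.tsum_mul_left]
  rw [lintegral_tsum (fun k => by fun_prop), lintegral_tsum (fun k => by fun_prop)]
  refine tsum_congr fun k => ?_
  have h2 : ∀ x, H ‖x‖ * (ENNReal.ofReal (((2 * k).factorial : ℝ)⁻¹)
      * ENNReal.ofReal (inner ℝ x y ^ (2 * k)))
      = ENNReal.ofReal (((2 * k).factorial : ℝ)⁻¹)
        * (H ‖x‖ * ENNReal.ofReal (inner ℝ x y ^ (2 * k))) := fun x => mul_left_comm _ _ _
  simp_rw [h2]
  rw [lintegral_const_mul _ (by fun_prop), hμ.lintegral_mul_inner_pow hN hH,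
    ← lintegral_const_mul _ (by fun_prop)]
  refine lintegral_congr fun x => ?_
  rw [mul_left_comm, ← ENNReal.ofReal_mul (by positivity), inv_mul_cancel_left₀ (by positivity)]

/-- The density at `y` of the law of `X + Z`, with `X` of law `μ` and `Z` normal of law
`N(0, σ² Id)`. -/
def outputDensity (μ : Measure (EuclideanSpace ℝ (Fin N))) (σ : ℝ)
    (y : EuclideanSpace ℝ (Fin N)) : ℝ :=
  ∫ x, gaussDensity N σ (y - x) ∂μ

lemma integrable_gaussDensity_sub [IsFiniteMeasure μ] {σ : ℝ} (hσ : 0 < σ)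
    (y : EuclideanSpace ℝ (Fin N)) : Integrable (fun x => gaussDensity N σ (y - x)) μ := by
  refine Integrable.of_bound (by fun_prop) ((2 * Real.pi * σ ^ 2) ^ (-(N : ℝ) / 2))
    (ae_of_all _ fun x => ?_)
  rw [Real.norm_of_nonneg (gaussDensity_pos hσ _).le]
  exact gaussDensity_le hσ _

lemma ofReal_outputDensity [IsFiniteMeasure μ] {σ : ℝ} (hσ : 0 < σ)
    (y : EuclideanSpace ℝ (Fin N)) :
    ENNReal.ofReal (outputDensity μ σ y) = ∫⁻ x, ENNReal.ofReal (gaussDensity N σ (y - x)) ∂μ :=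
  ofReal_integral_eq_lintegral_ofReal (integrable_gaussDensity_sub hσ y)
    (ae_of_all _ fun _ => (gaussDensity_pos hσ _).le)

lemma outputDensity_pos [IsProbabilityMeasure μ] {σ : ℝ} (hσ : 0 < σ)
    (y : EuclideanSpace ℝ (Fin N)) : 0 < outputDensity μ σ y := by
  refine (integral_pos_iff_support_of_nonneg (fun _ => (gaussDensity_pos hσ _).le)
    (integrable_gaussDensity_sub hσ y)).2 ?_
  have : Function.support (fun x => gaussDensity N σ (y - x)) = univ :=
    eq_univ_of_forall fun x => (gaussDensity_pos hσ _).ne'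
  simp [this]

lemma outputDensity_le [IsProbabilityMeasure μ] {σ : ℝ} (hσ : 0 < σ)
    (y : EuclideanSpace ℝ (Fin N)) :
    outputDensity μ σ y ≤ (2 * Real.pi * σ ^ 2) ^ (-(N : ℝ) / 2) := by
  refine (integral_mono (integrable_gaussDensity_sub hσ y) (integrable_const _)
    fun x => gaussDensity_le hσ _).trans_eq ?_
  simp

@[fun_prop]
lemma measurable_outputDensity [SFinite μ] {σ : ℝ} : Measurable (outputDensity μ σ) := by
  have h : Measurable (fun p : EuclideanSpace ℝ (Fin N) × EuclideanSpace ℝ (Fin N) =>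
    gaussDensity N σ (p.1 - p.2)) := by fun_prop
  exact h.stronglyMeasurable.integral_prod_right.measurable

lemma RotationallyInvariant.outputDensity_eq [IsFiniteMeasure μ] (hμ : RotationallyInvariant μ)
    {σ : ℝ} {y z : EuclideanSpace ℝ (Fin N)} (h : ‖y‖ = ‖z‖) :
    outputDensity μ σ y = outputDensity μ σ z := by
  obtain ⟨A, rfl⟩ := exists_linearIsometryEquiv_apply_eq h
  unfold outputDensity
  conv_rhs => rw [← hμ A, integral_map A.continuous.aemeasurable (by fun_prop)]
  simp_rw [← map_sub, gaussDensity, LinearIsometryEquiv.norm_map]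

/-- The noncentral chi density with values in `[0, ∞]`, written as a power series. -/
def chiSeries (N : ℕ) (r s : ℝ) : ℝ≥0∞ :=
  ENNReal.ofReal (2 ^ (1 - (N : ℝ) / 2) / Real.Gamma ((N : ℝ) / 2) * r ^ (N - 1)
      * Real.exp (-(r ^ 2 + s ^ 2) / 2))
    * ∑' k, ENNReal.ofReal (besselCoeff N k * (r * s) ^ (2 * k))

@[fun_prop]
lemma measurable_chiSeries (N : ℕ) (r : ℝ) : Measurable (chiSeries N r) := by
  unfold chiSeries
  refine Measurable.mul (by fun_prop) (Measurable.tsum fun k => by fun_prop)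

/-- Pulling `(r s / 2)^(N/2-1)` out of the Bessel series cancels the power of `s` and completes
`r^(N/2)` to `r^(N-1)`. At `s = 0` only the term `k = 0` survives, which gives the prescribed limit
value. -/
lemma chiDensity_eq_toReal_chiSeries {N : ℕ} (hN : 1 ≤ N) {r s : ℝ} (hr : 0 < r) (hs : 0 ≤ s) :
    chiDensity N r s = (chiSeries N r s).toReal := by
  have hN0 : (0 : ℝ) < N := by exact_mod_cast hN
  have hG := Real.Gamma_pos_of_pos (show 0 < (N : ℝ) / 2 by positivity)
  have h2 : (2 : ℝ) ^ (1 - (N : ℝ) / 2) = (2 ^ ((N : ℝ) / 2 - 1))⁻¹ := by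
    rw [← Real.rpow_neg two_pos.le, neg_sub]
  have h2' := Real.rpow_pos_of_pos two_pos ((N : ℝ) / 2 - 1)
  have hterm : ∀ k, 0 ≤ besselCoeff N k * (r * s) ^ (2 * k) := fun k =>
    mul_nonneg (besselCoeff_pos hN k).le (by positivity)
  rw [chiSeries, ENNReal.toReal_mul, ENNReal.toReal_ofReal (by positivity),
    ENNReal.tsum_toReal_eq (fun _ => ENNReal.ofReal_ne_top)]
  simp_rw [ENNReal.toReal_ofReal (hterm _)]
  rcases hs.eq_or_lt with rfl | hs
  · rw [tsum_eq_single 0 (fun k hk => by simp [hk]), chiDensity, if_pos rfl]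
    simp only [besselCoeff, h2]
    simp
    field_simp
  · have hbes : besselI ((N : ℝ) / 2 - 1) (r * s)
        = (r * s / 2) ^ ((N : ℝ) / 2 - 1) / Real.Gamma ((N : ℝ) / 2)
          * ∑' k, besselCoeff N k * (r * s) ^ (2 * k) := by
      rw [besselI, ← tsum_mul_left]
      refine tsum_congr fun k => ?_
      have hGk := Real.Gamma_pos_of_pos (show 0 < (N : ℝ) / 2 + k by positivity)
      rw [Real.rpow_add (by positivity), besselCoeff,
        show (k : ℝ) + ((N : ℝ) / 2 - 1) + 1 = N / 2 + k by ring,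
        show (2 : ℝ) * k = ((2 * k : ℕ) : ℝ) by push_cast; rfl, Real.rpow_natCast, div_pow,
        pow_mul (2 : ℝ) 2 k]
      norm_num
      field_simp
    have hrN : r ^ (N - 1) = r ^ ((N : ℝ) / 2) * r ^ ((N : ℝ) / 2 - 1) := by
      rw [← Real.rpow_add hr, ← Real.rpow_natCast, Nat.cast_sub hN]
      congr 1
      push_cast
      ring
    rw [chiDensity, if_neg hs.ne', hbes, h2, hrN, Real.div_rpow (by positivity) two_pos.le,
      Real.mul_rpow hr.le hs.le]
    have := Real.rpow_pos_of_pos hs ((N : ℝ) / 2 - 1)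
    field_simp

lemma sphereArea_mul_gaussConst {N : ℕ} {σ : ℝ} (hσ : 0 < σ) :
    sphereArea N * σ ^ N * (2 * Real.pi * σ ^ 2) ^ (-(N : ℝ) / 2)
      = 2 ^ (1 - (N : ℝ) / 2) / Real.Gamma ((N : ℝ) / 2) := by
  have hpi := Real.pi_pos
  have h1 : (2 * Real.pi * σ ^ 2) ^ (-(N : ℝ) / 2)
      = (2 ^ ((N : ℝ) / 2))⁻¹ * (Real.pi ^ ((N : ℝ) / 2))⁻¹ * (σ ^ N)⁻¹ := by
    rw [neg_div, Real.rpow_neg (by positivity), Real.mul_rpow (by positivity) (by positivity),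
      Real.mul_rpow (by positivity) (by positivity), ← Real.rpow_natCast σ 2,
      ← Real.rpow_mul hσ.le, mul_inv, mul_inv]
    congr 2
    rw [← Real.rpow_natCast]
    congr 1
    push_cast
    ring
  rw [h1, sphereArea, Real.rpow_sub two_pos, Real.rpow_one]
  field_simp

/-- Expanding `‖y - x‖²` splits the Gaussian into `exp (-r²/2)`, the radial weight `H ‖x‖` and `exp
⟨x, w⟩` with `w = y / σ²`; the Laplace transform formula then applies. -/
lemma RotationallyInvariant.lintegral_chiSeries [IsFiniteMeasure μ] (hN : 1 ≤ N)
    (hμ : RotationallyInvariant μ) {σ : ℝ} (hσ : 0 < σ) {r : ℝ} (hr : 0 < r)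
    {y : EuclideanSpace ℝ (Fin N)} (hy : ‖y‖ = σ * r) :
    ∫⁻ x, chiSeries N r (‖x‖ / σ) ∂μ
      = ENNReal.ofReal (sphereArea N * σ ^ N * r ^ (N - 1) * outputDensity μ σ y) := by
  have hpi := Real.pi_pos
  have hS := sphereArea_pos hN
  have hN0 : (0 : ℝ) < N := by exact_mod_cast hN
  have hG := Real.Gamma_pos_of_pos (show 0 < (N : ℝ) / 2 by positivity)
  set c : ℝ := 2 ^ (1 - (N : ℝ) / 2) / Real.Gamma ((N : ℝ) / 2) * r ^ (N - 1)
    * Real.exp (-r ^ 2 / 2) with hc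
  have hc0 : 0 ≤ c := by positivity
  set w : EuclideanSpace ℝ (Fin N) := (σ ^ 2)⁻¹ • y with hw
  have hwn : ‖w‖ = r / σ := by
    rw [hw, norm_smul, hy, Real.norm_of_nonneg (by positivity)]
    field_simp
  set H : ℝ → ℝ≥0∞ := fun t => ENNReal.ofReal (Real.exp (-(t / σ) ^ 2 / 2)) with hH
  have hHm : Measurable H := by fun_prop
  have h1 : ∀ x : EuclideanSpace ℝ (Fin N), chiSeries N r (‖x‖ / σ)
      = ENNReal.ofReal c * (H ‖x‖
        * ∑' k, ENNReal.ofReal (besselCoeff N k * (‖w‖ * ‖x‖) ^ (2 * k))) := by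
    intro x
    rw [chiSeries, ← mul_assoc, ← ENNReal.ofReal_mul hc0, hc, mul_assoc _ (Real.exp _),
      ← Real.exp_add, hwn]
    congr 3
    · congr 2; ring
    · ext k
      congr 3
      ring
  have h2 : ∀ x : EuclideanSpace ℝ (Fin N),
      ENNReal.ofReal (sphereArea N * σ ^ N * r ^ (N - 1))
          * ENNReal.ofReal (gaussDensity N σ (y - x))
        = ENNReal.ofReal c * (H ‖x‖ * ENNReal.ofReal (Real.exp (inner ℝ x w))) := by
    intro x
    rw [← ENNReal.ofReal_mul (by positivity), ← ENNReal.ofReal_mul (by positivity),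
      ← ENNReal.ofReal_mul hc0, hc, ← sphereArea_mul_gaussConst hσ, gaussDensity,
      ← Real.exp_add, mul_assoc _ (Real.exp _), ← Real.exp_add]
    have : -‖y - x‖ ^ 2 / (2 * σ ^ 2)
        = -r ^ 2 / 2 + (-(‖x‖ / σ) ^ 2 / 2 + inner ℝ x w) := by
      rw [norm_sub_sq_real, hy, hw, inner_smul_right, real_inner_comm]
      field_simp
      ring
    rw [this]
    congr 1
    ring
  have h3 : Measurable fun x : EuclideanSpace ℝ (Fin N) =>
      ∑' k, ENNReal.ofReal (besselCoeff N k * (‖w‖ * ‖x‖) ^ (2 * k)) :=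
    Measurable.tsum fun k => by fun_prop
  simp_rw [h1]
  rw [lintegral_const_mul _ (by fun_prop), ← hμ.lintegral_mul_exp_inner hN hHm,
    ← lintegral_const_mul _ (by fun_prop),
    ENNReal.ofReal_mul (p := sphereArea N * σ ^ N * r ^ (N - 1)) (by positivity),
    ofReal_outputDensity hσ, ← lintegral_const_mul _ (by fun_prop)]
  exact lintegral_congr fun x => (h2 x).symm

/-- The mixture of noncentral chi densities in terms of the density of the output. -/
lemma RotationallyInvariant.radialMixture_eq [IsProbabilityMeasure μ] (hN : 1 ≤ N)
    (hμ : RotationallyInvariant μ) {σ : ℝ} (hσ : 0 < σ) {r : ℝ} (hr : 0 < r)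
    {y : EuclideanSpace ℝ (Fin N)} (hy : ‖y‖ = σ * r) :
    radialMixture N σ (μ.map fun x => ‖x‖) r
      = sphereArea N * σ ^ N * r ^ (N - 1) * outputDensity μ σ y := by
  have hS := sphereArea_pos hN
  have hp := outputDensity_pos (μ := μ) hσ y
  have h := hμ.lintegral_chiSeries hN hσ hr hy
  have hm : Measurable fun s => chiSeries N r (s / σ) := by fun_prop
  rw [← lintegral_map hm measurable_norm] at h
  have hae : (fun s => chiDensity N r (s / σ)) =ᵐ[μ.map fun x => ‖x‖]
      fun s => (chiSeries N r (s / σ)).toReal := by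
    rw [Filter.EventuallyEq]
    -- Kernel and series are compared only for `s ≥ 0`, where the law of the norm is carried.
    have h0 : ∀ᵐ s ∂(μ.map fun x => ‖x‖), 0 ≤ s :=
      (ae_map_iff (by fun_prop) measurableSet_Ici).2 (ae_of_all _ fun x => norm_nonneg x)
    filter_upwards [h0] with s hs
    exact chiDensity_eq_toReal_chiSeries hN hr (by positivity)
  rw [radialMixture, integral_congr_ae hae, integral_toReal hm.aemeasurable
    (ae_lt_top hm (by rw [h]; exact ENNReal.ofReal_ne_top)), h,
    ENNReal.toReal_ofReal (by positivity)]

end Rotation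


/-! ### Extended-valued integrals. -/

section ExtIntegral

variable {α : Type*} [MeasurableSpace α] {μ : Measure α} {f g : α → ℝ}

lemma extIntegral_congr_ae (h : f =ᵐ[μ] g) : extIntegral μ f = extIntegral μ g := by
  unfold extIntegral
  congr 2
  · exact lintegral_congr_ae (h.mono fun x hx => by simp only [hx])
  · exact lintegral_congr_ae (h.mono fun x hx => by simp only [hx])

lemma extIntegral_eq_integral (hf : Integrable f μ) :
    extIntegral μ f = ((∫ x, f x ∂μ : ℝ) : EReal) := by
  rw [integral_eq_lintegral_pos_part_sub_lintegral_neg_part hf, EReal.coe_sub,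
    EReal.coe_ennreal_toReal hf.lintegral_lt_top.ne,
    EReal.coe_ennreal_toReal (x := ∫⁻ x, ENNReal.ofReal (-f x) ∂μ) hf.neg.lintegral_lt_top.ne]
  rfl

/-- With a finite positive part, failure of integrability means that the negative part is infinite.
-/
lemma extIntegral_eq_bot (hfm : AEStronglyMeasurable f μ)
    (hpos : ∫⁻ x, ENNReal.ofReal (f x) ∂μ ≠ ⊤) (hf : ¬ Integrable f μ) :
    extIntegral μ f = ⊥ := by
  have hneg : ∫⁻ x, ENNReal.ofReal (-f x) ∂μ = ⊤ := by
    by_contra hneg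
    refine hf ⟨hfm, ?_⟩
    have h : ∀ x, ‖f x‖ₑ = ENNReal.ofReal (f x) + ENNReal.ofReal (-f x) := by
      intro x
      rw [← ofReal_norm, Real.norm_eq_abs]
      rcases le_total 0 (f x) with h | h
      · rw [abs_of_nonneg h, ENNReal.ofReal_of_nonpos (neg_nonpos.2 h), add_zero]
      · rw [abs_of_nonpos h, ENNReal.ofReal_of_nonpos h, zero_add]
    rw [HasFiniteIntegral, lintegral_congr h,
      lintegral_add_left' hfm.aemeasurable.ennreal_ofReal]
    exact (ENNReal.add_ne_top.2 ⟨hpos, hneg⟩).lt_top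
  rw [extIntegral, hneg, EReal.coe_ennreal_top]
  rw [sub_eq_add_neg, EReal.neg_top, EReal.add_bot]

lemma lintegral_ofReal_add_ne_top (hg : Integrable g μ)
    (hpos : ∫⁻ x, ENNReal.ofReal (f x) ∂μ ≠ ⊤) :
    ∫⁻ x, ENNReal.ofReal (f x + g x) ∂μ ≠ ⊤ := by
  refine ne_top_of_le_ne_top (ENNReal.add_ne_top.2 ⟨hpos, hg.lintegral_lt_top.ne⟩) ?_
  rw [← lintegral_add_right' _ hg.1.aemeasurable.ennreal_ofReal]
  exact lintegral_mono fun x => ENNReal.ofReal_add_le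

/-- If `f` is not integrable, neither is `f + g`, and both sides are `⊥`. -/
lemma extIntegral_add_integrable (hfm : AEStronglyMeasurable f μ) (hg : Integrable g μ)
    (hpos : ∫⁻ x, ENNReal.ofReal (f x) ∂μ ≠ ⊤) :
    extIntegral μ (fun x => f x + g x)
      = extIntegral μ f + ((∫ x, g x ∂μ : ℝ) : EReal) := by
  by_cases hf : Integrable f μ
  · rw [extIntegral_eq_integral hf, extIntegral_eq_integral (f := fun x => f x + g x) (hf.add hg),
      integral_add hf hg,
      EReal.coe_add]
  · rw [extIntegral_eq_bot hfm hpos hf, EReal.bot_add]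
    refine extIntegral_eq_bot (hfm.add hg.1) (lintegral_ofReal_add_ne_top hg hpos) fun h => hf ?_
    exact (h.sub hg).congr (ae_of_all _ fun x => by simp)

end ExtIntegral

/-! ### Differential entropy of the Gaussian. -/

section Entropy

variable {N : ℕ}

lemma diffEntropy_withDensity {f : EuclideanSpace ℝ (Fin N) → ℝ} (hf : Measurable f)
    (h0 : ∀ y, 0 ≤ f y) :
    diffEntropy (volume.withDensity fun y => ENNReal.ofReal (f y))
      = -extIntegral volume fun y => f y * Real.logb 2 (f y) := by
  rw [diffEntropy]
  congr 1
  refine extIntegral_congr_ae ?_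
  filter_upwards [Measure.rnDeriv_withDensity volume hf.ennreal_ofReal] with y hy
  rw [hy, ENNReal.toReal_ofReal (h0 y)]

lemma integrable_gaussDensity (hN : 1 ≤ N) {σ : ℝ} (hσ : 0 < σ) :
    Integrable (gaussDensity N σ) := by
  refine (lintegral_ofReal_ne_top_iff_integrable (by fun_prop)
    (ae_of_all _ fun x => (gaussDensity_pos hσ x).le)).1 ?_
  simp [lintegral_gaussDensity hN hσ]

lemma integral_gaussDensity (hN : 1 ≤ N) {σ : ℝ} (hσ : 0 < σ) :
    ∫ x, gaussDensity N σ x = 1 := by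
  rw [integral_eq_lintegral_of_nonneg_ae (ae_of_all _ fun x => (gaussDensity_pos hσ x).le)
    (by fun_prop), lintegral_gaussDensity hN hσ, ENNReal.toReal_one]

lemma lintegral_norm_sq_mul_gaussDensity (hN : 1 ≤ N) {σ : ℝ} (hσ : 0 < σ) :
    ∫⁻ x : EuclideanSpace ℝ (Fin N), ENNReal.ofReal (‖x‖ ^ 2 * gaussDensity N σ x)
      = ENNReal.ofReal (N * σ ^ 2) := by
  have hN0 : (0 : ℝ) < N := by exact_mod_cast hN
  have hG := Real.Gamma_pos_of_pos (show 0 < (N : ℝ) / 2 by positivity)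
  have h := lintegral_norm_pow_mul_gaussDensity hN hσ 1
  rw [Nat.cast_one, Real.Gamma_add_one (by positivity)] at h
  rw [mul_one] at h
  rw [h]
  congr 1
  field_simp

lemma integrable_norm_sq_mul_gaussDensity (hN : 1 ≤ N) {σ : ℝ} (hσ : 0 < σ) :
    Integrable fun x : EuclideanSpace ℝ (Fin N) => ‖x‖ ^ 2 * gaussDensity N σ x := by
  refine (lintegral_ofReal_ne_top_iff_integrable (by fun_prop) (ae_of_all _ fun x =>
    mul_nonneg (by positivity) (gaussDensity_pos hσ x).le)).1 ?_
  rw [lintegral_norm_sq_mul_gaussDensity hN hσ]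
  exact ENNReal.ofReal_ne_top

lemma integral_norm_sq_mul_gaussDensity (hN : 1 ≤ N) {σ : ℝ} (hσ : 0 < σ) :
    ∫ x : EuclideanSpace ℝ (Fin N), ‖x‖ ^ 2 * gaussDensity N σ x = N * σ ^ 2 := by
  rw [integral_eq_lintegral_of_nonneg_ae (ae_of_all _ fun x =>
      mul_nonneg (by positivity) (gaussDensity_pos hσ x).le) (by fun_prop),
    lintegral_norm_sq_mul_gaussDensity hN hσ, ENNReal.toReal_ofReal (by positivity)]

lemma gaussDensity_mul_log {σ : ℝ} (hσ : 0 < σ) (x : EuclideanSpace ℝ (Fin N)) :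
    gaussDensity N σ x * Real.log (gaussDensity N σ x)
      = -(N : ℝ) / 2 * Real.log (2 * Real.pi * σ ^ 2) * gaussDensity N σ x
        - 1 / (2 * σ ^ 2) * (‖x‖ ^ 2 * gaussDensity N σ x) := by
  have hpi := Real.pi_pos
  have h : Real.log (gaussDensity N σ x)
      = -(N : ℝ) / 2 * Real.log (2 * Real.pi * σ ^ 2) + -‖x‖ ^ 2 / (2 * σ ^ 2) := by
    rw [gaussDensity, Real.log_mul (by positivity) (Real.exp_pos _).ne', Real.log_exp,
      Real.log_rpow (by positivity)]
  rw [h]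
  ring

lemma integrable_gaussDensity_mul_log (hN : 1 ≤ N) {σ : ℝ} (hσ : 0 < σ) :
    Integrable fun x => gaussDensity N σ x * Real.log (gaussDensity N σ x) := by
  simp_rw [gaussDensity_mul_log hσ]
  exact ((integrable_gaussDensity hN hσ).const_mul _).sub
    ((integrable_norm_sq_mul_gaussDensity hN hσ).const_mul _)

lemma integral_gaussDensity_mul_log (hN : 1 ≤ N) {σ : ℝ} (hσ : 0 < σ) :
    ∫ x, gaussDensity N σ x * Real.log (gaussDensity N σ x)
      = -(N / 2 * (Real.log (2 * Real.pi * σ ^ 2) + 1)) := by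
  simp_rw [gaussDensity_mul_log hσ]
  rw [integral_sub ((integrable_gaussDensity hN hσ).const_mul _)
    ((integrable_norm_sq_mul_gaussDensity hN hσ).const_mul _), integral_const_mul,
    integral_const_mul, integral_gaussDensity hN hσ, integral_norm_sq_mul_gaussDensity hN hσ]
  field_simp
  ring

lemma mul_logb_eq (p : ℝ) : p * Real.logb 2 p = p * Real.log p / Real.log 2 :=
  mul_div_assoc' _ _ _

lemma extIntegral_gaussDensity (hN : 1 ≤ N) {σ : ℝ} (hσ : 0 < σ) :
    extIntegral volume (fun x => gaussDensity N σ x * Real.logb 2 (gaussDensity N σ x))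
      = ((-(N / 2 * (Real.log (2 * Real.pi * σ ^ 2) + 1)) / Real.log 2 : ℝ) : EReal) := by
  simp_rw [mul_logb_eq]
  rw [extIntegral_eq_integral ((integrable_gaussDensity_mul_log hN hσ).div_const _),
    integral_div, integral_gaussDensity_mul_log hN hσ]

end Entropy

/-! ### From the output density to the radial formula. -/

section Radial

variable {N : ℕ} {μ : Measure (EuclideanSpace ℝ (Fin N))} [IsProbabilityMeasure μ] {σ : ℝ}

lemma lintegral_outputDensity (hN : 1 ≤ N) (hσ : 0 < σ) :
    ∫⁻ y, ENNReal.ofReal (outputDensity μ σ y) = 1 := by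
  simp_rw [ofReal_outputDensity hσ]
  rw [lintegral_lintegral_swap (by fun_prop)]
  have (x : EuclideanSpace ℝ (Fin N)) :
      ∫⁻ y, ENNReal.ofReal (gaussDensity N σ (y - x)) = 1 := by
    rw [lintegral_sub_right_eq_self (fun y => ENNReal.ofReal (gaussDensity N σ y)),
      lintegral_gaussDensity hN hσ]
  simp [this]

/-- Since `p` is bounded by the Gaussian peak `C`, `p log p ≤ p log C`, and `p` has mass one. This
excludes `∞ - ∞` in the output entropy. -/
lemma lintegral_ofReal_outputDensity_mul_logb_ne_top (hN : 1 ≤ N) (hσ : 0 < σ) :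
    ∫⁻ y, ENNReal.ofReal (outputDensity μ σ y * Real.logb 2 (outputDensity μ σ y)) ≠ ⊤ := by
  set L := Real.logb 2 ((2 * Real.pi * σ ^ 2) ^ (-(N : ℝ) / 2))
  have hle : ∀ y, ENNReal.ofReal (outputDensity μ σ y * Real.logb 2 (outputDensity μ σ y))
      ≤ ENNReal.ofReal (outputDensity μ σ y) * ENNReal.ofReal L := fun y => by
    have hp := outputDensity_pos (μ := μ) hσ y
    rw [← ENNReal.ofReal_mul hp.le]
    refine ENNReal.ofReal_le_ofReal (mul_le_mul_of_nonneg_left ?_ hp.le)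
    exact Real.logb_le_logb_of_le one_lt_two hp (outputDensity_le hσ y)
  refine ne_top_of_le_ne_top ?_ (lintegral_mono hle)
  rw [lintegral_mul_const _ (by fun_prop), lintegral_outputDensity hN hσ, one_mul]
  exact ENNReal.ofReal_ne_top

/-- In polar coordinates, the integral of a function of the output density over `ℝ^N` is the
integral of the corresponding function of `fR r / r^(N-1)` over the radii. -/
lemma RotationallyInvariant.lintegral_comp_outputDensity (hN : 1 ≤ N)
    (hμ : RotationallyInvariant μ) (hσ : 0 < σ) {e : EuclideanSpace ℝ (Fin N)} (he : ‖e‖ = 1)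
    {F : ℝ → ℝ → ℝ≥0∞} (hF : Measurable F.uncurry) :
    ∫⁻ y, F (‖y‖ / σ) (outputDensity μ σ y)
      = ∫⁻ r in Ioi (0 : ℝ), ENNReal.ofReal (sphereArea N * σ ^ N * r ^ (N - 1))
          * F r (outputDensity μ σ ((σ * r) • e)) := by
  have hS := sphereArea_pos hN
  have hq : Measurable fun r => outputDensity μ σ ((σ * r) • e) :=
    measurable_outputDensity.comp (by fun_prop)
  have hG : Measurable fun r => F r (outputDensity μ σ ((σ * r) • e)) :=
    hF.comp (measurable_id.prodMk hq)
  have h1 : ∀ y : EuclideanSpace ℝ (Fin N), F (‖y‖ / σ) (outputDensity μ σ y)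
      = F (‖y‖ / σ) (outputDensity μ σ ((σ * (‖y‖ / σ)) • e)) := fun y => by
    congr 1
    refine hμ.outputDensity_eq ?_
    rw [mul_div_cancel₀ _ hσ.ne', norm_smul, norm_norm, he, mul_one]
  rw [lintegral_congr h1, lintegral_fun_norm_div hN hσ hG, ← lintegral_const_mul _ (by fun_prop)]
  refine setLIntegral_congr_fun measurableSet_Ioi fun r (hr : 0 < r) => ?_
  rw [← mul_assoc, ← ENNReal.ofReal_mul (by positivity)]

variable {fR : ℝ → ℝ}

/-- The law of the normalized output radius. -/
lemma RotationallyInvariant.map_norm_div_withDensity (hN : 1 ≤ N)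
    (hμ : RotationallyInvariant μ) (hσ : 0 < σ)
    (hfR : fR = radialMixture N σ (μ.map fun x => ‖x‖)) :
    (volume.withDensity fun y => ENNReal.ofReal (outputDensity μ σ y)).map (fun y => ‖y‖ / σ)
      = (volume.restrict (Ioi 0)).withDensity fun r => ENNReal.ofReal (fR r) := by
  have hS := sphereArea_pos hN
  obtain ⟨e, he⟩ := exists_norm_eq_one hN
  ext A hA
  have hm : Measurable fun y : EuclideanSpace ℝ (Fin N) => ‖y‖ / σ := by fun_prop
  rw [Measure.map_apply hm hA, withDensity_apply _ (hm hA), withDensity_apply _ hA,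
    ← lintegral_indicator (hm hA), ← lintegral_indicator hA]
  have h := hμ.lintegral_comp_outputDensity hN hσ he
    (F := fun r p => A.indicator (fun _ => ENNReal.ofReal p) r) (by
      have : Function.uncurry (fun r p => A.indicator (fun _ => ENNReal.ofReal p) r)
          = (Prod.fst ⁻¹' A).indicator fun x : ℝ × ℝ => ENNReal.ofReal x.2 := rfl
      rw [this]
      exact Measurable.indicator (by fun_prop) (measurable_fst hA))
  refine Eq.trans (lintegral_congr fun y => rfl) (h.trans ?_)
  refine setLIntegral_congr_fun measurableSet_Ioi fun r (hr : 0 < r) => ?_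
  have hf : fR r = sphereArea N * σ ^ N * r ^ (N - 1) * outputDensity μ σ ((σ * r) • e) := by
    rw [hfR]
    refine hμ.radialMixture_eq hN hσ hr ?_
    rw [norm_smul, he, mul_one, Real.norm_of_nonneg (by positivity)]
  by_cases hrA : r ∈ A
  · simp only [indicator_of_mem hrA]
    rw [hf, ENNReal.ofReal_mul (p := sphereArea N * σ ^ N * r ^ (N - 1)) (by positivity)]
  · simp [indicator_of_notMem hrA]

/-- The rate formula in terms of the density of the output on `ℝ^N`. -/
lemma RotationallyInvariant.radialRate_eq (hN : 1 ≤ N)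
    (hμ : RotationallyInvariant μ) (hσ : 0 < σ)
    (hfR : fR = radialMixture N σ (μ.map fun x => ‖x‖)) :
    (∫⁻ r in Ioi (0 : ℝ), ENNReal.ofReal (fR r * Real.logb 2 (fR r / r ^ (N - 1)))) ≠ ⊤
    ∧ radialRate N fR
      = -extIntegral volume (fun y => outputDensity μ σ y * Real.logb 2 (outputDensity μ σ y))
        + ((-(N / 2 * (Real.log (2 * Real.pi * σ ^ 2) + 1)) / Real.log 2 : ℝ) : EReal) := by
  have hS := sphereArea_pos hN
  have hpi := Real.pi_pos
  have hN0 : (0 : ℝ) < N := by exact_mod_cast hN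
  have hGam := Real.Gamma_pos_of_pos (show 0 < (N : ℝ) / 2 by positivity)
  obtain ⟨e, he⟩ := exists_norm_eq_one hN
  set K := sphereArea N * σ ^ N with hK
  have hK0 : 0 < K := by positivity
  set q : ℝ → ℝ := fun r => outputDensity μ σ ((σ * r) • e) with hq
  have hqm : Measurable q := measurable_outputDensity.comp (by fun_prop)
  have hq0 : ∀ r, 0 < q r := fun r => outputDensity_pos hσ _
  have hf : ∀ r ∈ Ioi (0 : ℝ), fR r = K * r ^ (N - 1) * q r := by
    intro r (hr : 0 < r)
    rw [hfR]
    refine hμ.radialMixture_eq hN hσ hr ?_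
    rw [norm_smul, he, mul_one, Real.norm_of_nonneg (by positivity)]
  -- Since `fR r / r^(N-1) = K q r`, the logarithm splits: `G` is `p log₂ p` in polar coordinates,
  -- and `g` is `fR` times `log₂ K`, with integral `log₂ K`.
  set G : ℝ → ℝ := fun r => K * r ^ (N - 1) * (q r * Real.logb 2 (q r)) with hG
  set g : ℝ → ℝ := fun r => Real.logb 2 K * (K * r ^ (N - 1) * q r) with hg
  have hlogb : Measurable (Real.logb 2) := Real.measurable_log.div_const _
  have hGm : Measurable G :=
    (by fun_prop : Measurable fun r : ℝ => K * r ^ (N - 1)).mul (hqm.mul (hlogb.comp hqm))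
  have hsum : ∀ r ∈ Ioi (0 : ℝ), fR r * Real.logb 2 (fR r / r ^ (N - 1)) = G r + g r := by
    intro r hr
    have hr0 : 0 < r := hr
    rw [hf r hr, show K * r ^ (N - 1) * q r / r ^ (N - 1) = K * q r by field_simp,
      Real.logb_mul hK0.ne' (hq0 r).ne', hG, hg]
    ring
  have hmass : ∫⁻ r in Ioi (0 : ℝ), ENNReal.ofReal (K * r ^ (N - 1) * q r) = 1 := by
    have h := hμ.lintegral_comp_outputDensity hN hσ he (F := fun _ p => ENNReal.ofReal p)
      (ENNReal.measurable_ofReal.comp measurable_snd)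
    rw [lintegral_outputDensity hN hσ] at h
    rw [h]
    refine setLIntegral_congr_fun measurableSet_Ioi fun r (hr : 0 < r) => ?_
    rw [← ENNReal.ofReal_mul (by positivity)]
  have hnn : 0 ≤ᵐ[volume.restrict (Ioi (0 : ℝ))] fun r => K * r ^ (N - 1) * q r := by
    filter_upwards [ae_restrict_mem measurableSet_Ioi] with r (hr : 0 < r)
    have := hq0 r
    positivity
  have hfm : Measurable fun r => K * r ^ (N - 1) * q r := by fun_prop
  have hfint : Integrable (fun r => K * r ^ (N - 1) * q r) (volume.restrict (Ioi (0 : ℝ))) :=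
    (lintegral_ofReal_ne_top_iff_integrable hfm.aestronglyMeasurable hnn).1 (by simp [hmass])
  have hfone : ∫ r in Ioi (0 : ℝ), K * r ^ (N - 1) * q r = 1 := by
    rw [integral_eq_lintegral_of_nonneg_ae hnn hfm.aestronglyMeasurable, hmass, ENNReal.toReal_one]
  have hpos : ∫⁻ r in Ioi (0 : ℝ), ENNReal.ofReal (G r)
      = ∫⁻ y, ENNReal.ofReal (outputDensity μ σ y * Real.logb 2 (outputDensity μ σ y)) := by
    rw [hμ.lintegral_comp_outputDensity hN hσ he
      (F := fun _ p => ENNReal.ofReal (p * Real.logb 2 p))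
      ((measurable_id.mul hlogb).ennreal_ofReal.comp measurable_snd)]
    refine setLIntegral_congr_fun measurableSet_Ioi fun r (hr : 0 < r) => ?_
    rw [← ENNReal.ofReal_mul (by positivity)]
  have hneg : ∫⁻ r in Ioi (0 : ℝ), ENNReal.ofReal (-G r)
      = ∫⁻ y, ENNReal.ofReal (-(outputDensity μ σ y * Real.logb 2 (outputDensity μ σ y))) := by
    rw [hμ.lintegral_comp_outputDensity hN hσ he
      (F := fun _ p => ENNReal.ofReal (-(p * Real.logb 2 p)))
      ((measurable_id.mul hlogb).neg.ennreal_ofReal.comp measurable_snd)]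
    refine setLIntegral_congr_fun measurableSet_Ioi fun r (hr : 0 < r) => ?_
    rw [← ENNReal.ofReal_mul (by positivity), mul_neg]
  have hfin : ∫⁻ r in Ioi (0 : ℝ), ENNReal.ofReal (G r) ≠ ⊤ := by
    rw [hpos]
    exact lintegral_ofReal_outputDensity_mul_logb_ne_top hN hσ
  have hgint : Integrable g (volume.restrict (Ioi (0 : ℝ))) := hfint.const_mul _
  have hsum_ae : (fun r => fR r * Real.logb 2 (fR r / r ^ (N - 1)))
      =ᵐ[volume.restrict (Ioi (0 : ℝ))] fun r => G r + g r :=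
    (ae_restrict_mem measurableSet_Ioi).mono hsum
  constructor
  · rw [setLIntegral_congr_fun measurableSet_Ioi fun r hr => by rw [hsum r hr]]
    exact lintegral_ofReal_add_ne_top hgint hfin
  · have hext : extIntegral (volume.restrict (Ioi (0 : ℝ))) G = extIntegral volume
        (fun y => outputDensity μ σ y * Real.logb 2 (outputDensity μ σ y)) := by
      rw [extIntegral, extIntegral, hpos, hneg]
    rw [radialRate, extIntegral_congr_ae hsum_ae,
      extIntegral_add_integrable hGm.aestronglyMeasurable hgint hfin, hext, integral_const_mul,
      hfone, mul_one, EReal.neg_add (by simp) (by simp), sub_eq_add_neg, add_assoc]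
    congr 1
    -- What remains is real: `-log₂ K` plus the constants of the rate equals `-(N/2) log₂ (2πeσ²)`.
    rw [← EReal.coe_neg, ← EReal.coe_add]
    congr 1
    have hl2 : Real.log 2 ≠ 0 := (Real.log_pos one_lt_two).ne'
    rw [hK, sphereArea]
    simp only [Real.logb]
    rw [Real.log_mul (by positivity) (by positivity), Real.log_div (by positivity) hGam.ne',
      Real.log_mul two_ne_zero (by positivity), Real.log_rpow hpi,
      Real.log_div two_ne_zero hGam.ne', Real.log_mul two_ne_zero (Real.exp_pos 1).ne',
      Real.log_exp, Real.log_mul (by positivity) (by positivity),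
      Real.log_mul two_ne_zero hpi.ne', Real.log_pow, Real.log_pow]
    field_simp
    push_cast
    ring

end Radial


/-! ### Mutual information as a difference of entropies. -/

section MutualInformation

variable {Ω : Type*} [MeasurableSpace Ω] {P : Measure Ω} [IsProbabilityMeasure P] {N : ℕ} {σ : ℝ}
  {X Z : Ω → EuclideanSpace ℝ (Fin N)}

/-- The joint law is the image of the product law of `(X, Z)` under the shear `(x, z) ↦ (x, x + z)`;
translation invariance of Lebesgue measure in each fibre gives the density. -/
lemma map_input_output_eq_withDensity (hX : Measurable X) (hZ : Measurable Z)
    (hind : IndepFun X Z P)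
    (hZlaw : P.map Z = volume.withDensity fun x => ENNReal.ofReal (gaussDensity N σ x)) :
    P.map (fun ω => (X ω, X ω + Z ω))
      = ((P.map X).prod volume).withDensity
          fun p => ENNReal.ofReal (gaussDensity N σ (p.2 - p.1)) := by
  have := Measure.isProbabilityMeasure_map (μ := P) hX.aemeasurable
  refine Measure.ext_of_lintegral _ fun F hF => ?_
  have h := (indepFun_iff_map_prod_eq_prod_map_map hX.aemeasurable hZ.aemeasurable).1 hind
  rw [hZlaw] at h
  have h1 : P.map (fun ω => (X ω, X ω + Z ω))
      = (P.map fun ω => (X ω, Z ω)).map fun p => (p.1, p.1 + p.2) := by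
    rw [Measure.map_map (by fun_prop) (by fun_prop)]
    rfl
  rw [h1, h, prod_withDensity_right (by fun_prop), lintegral_map hF (by fun_prop),
    lintegral_withDensity_eq_lintegral_mul _ (by fun_prop) (by fun_prop),
    lintegral_withDensity_eq_lintegral_mul _ (by fun_prop) hF,
    lintegral_prod _ (by fun_prop), lintegral_prod _ (by fun_prop)]
  refine lintegral_congr fun x => ?_
  refine Eq.trans ?_ (lintegral_add_left_eq_self (μ := volume)
    (fun y => ENNReal.ofReal (gaussDensity N σ (y - x)) * F (x, y)) x)
  simp

lemma map_output_eq_withDensity (hσ : 0 < σ) (hX : Measurable X) (hZ : Measurable Z)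
    (hind : IndepFun X Z P)
    (hZlaw : P.map Z = volume.withDensity fun x => ENNReal.ofReal (gaussDensity N σ x)) :
    P.map (fun ω => X ω + Z ω)
      = volume.withDensity fun y => ENNReal.ofReal (outputDensity (P.map X) σ y) := by
  have := Measure.isProbabilityMeasure_map (μ := P) hX.aemeasurable
  refine Measure.ext_of_lintegral _ fun F hF => ?_
  have h1 : P.map (fun ω => X ω + Z ω) = (P.map fun ω => (X ω, X ω + Z ω)).map Prod.snd := by
    rw [Measure.map_map (by fun_prop) (by fun_prop)]
    rfl
  rw [h1, map_input_output_eq_withDensity hX hZ hind hZlaw, lintegral_map hF (by fun_prop),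
    lintegral_withDensity_eq_lintegral_mul _ (by fun_prop) (by fun_prop),
    lintegral_withDensity_eq_lintegral_mul _ (by fun_prop) hF,
    lintegral_prod_symm _ (by fun_prop)]
  refine lintegral_congr fun y => ?_
  simp only [Pi.mul_apply]
  rw [lintegral_mul_const _ (by fun_prop), ofReal_outputDensity hσ]

lemma map_input_output_eq_withDensity_prod (hσ : 0 < σ) (hX : Measurable X) (hZ : Measurable Z)
    (hind : IndepFun X Z P)
    (hZlaw : P.map Z = volume.withDensity fun x => ENNReal.ofReal (gaussDensity N σ x)) :
    P.map (fun ω => (X ω, X ω + Z ω))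
      = ((P.map X).prod (P.map fun ω => X ω + Z ω)).withDensity fun p =>
          ENNReal.ofReal (gaussDensity N σ (p.2 - p.1) / outputDensity (P.map X) σ p.2) := by
  have := Measure.isProbabilityMeasure_map (μ := P) hX.aemeasurable
  rw [map_input_output_eq_withDensity hX hZ hind hZlaw,
    map_output_eq_withDensity hσ hX hZ hind hZlaw, prod_withDensity_right (by fun_prop),
    ← withDensity_mul _ (by fun_prop) (by fun_prop)]
  congr 1
  ext p
  have hp := outputDensity_pos (μ := P.map X) hσ p.2
  rw [Pi.mul_apply, ← ENNReal.ofReal_mul hp.le, mul_div_cancel₀ _ hp.ne']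

lemma mutualInfo_eq (hN : 1 ≤ N) (hσ : 0 < σ) (hX : Measurable X) (hZ : Measurable Z)
    (hind : IndepFun X Z P)
    (hZlaw : P.map Z = volume.withDensity fun x => ENNReal.ofReal (gaussDensity N σ x)) :
    ((mutualInfo P X (fun ω => X ω + Z ω) : ℝ≥0∞) : EReal)
      = -extIntegral volume (fun y => outputDensity (P.map X) σ y
            * Real.logb 2 (outputDensity (P.map X) σ y))
        + ((-(N / 2 * (Real.log (2 * Real.pi * σ ^ 2) + 1)) / Real.log 2 : ℝ) : EReal) := by
  have hl2 : 0 < Real.log 2 := Real.log_pos one_lt_two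
  set Y : Ω → EuclideanSpace ℝ (Fin N) := fun ω => X ω + Z ω with hY
  have hYm : Measurable Y := hX.add hZ
  have hμ := Measure.isProbabilityMeasure_map (μ := P) hX.aemeasurable
  have hν := Measure.isProbabilityMeasure_map (μ := P) hYm.aemeasurable
  have hXYm : Measurable fun ω => (X ω, Y ω) := hX.prodMk hYm
  have hJ := Measure.isProbabilityMeasure_map (μ := P) hXYm.aemeasurable
  set p := outputDensity (P.map X) σ with hp
  have hpm : Measurable p := measurable_outputDensity
  have hp0 : ∀ y, 0 < p y := outputDensity_pos hσ
  have hYlaw := map_output_eq_withDensity hσ hX hZ hind hZlaw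
  have hjoint := map_input_output_eq_withDensity_prod hσ hX hZ hind hZlaw
  set J := P.map fun ω => (X ω, Y ω) with hJdef
  set R := (P.map X).prod (P.map Y) with hR
  have hac : J ≪ R := by
    rw [hjoint]
    exact withDensity_absolutelyContinuous _ _
  have hllr : ∀ᵐ ω ∂P, llr J R (X ω, Y ω)
      = Real.log (gaussDensity N σ (Z ω)) - Real.log (p (Y ω)) := by
    have hd : Measurable fun q : EuclideanSpace ℝ (Fin N) × EuclideanSpace ℝ (Fin N) =>
        ENNReal.ofReal (gaussDensity N σ (q.2 - q.1) / p q.2) := by fun_prop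
    have h : J.rnDeriv R =ᵐ[J] fun q =>
        ENNReal.ofReal (gaussDensity N σ (q.2 - q.1) / p q.2) := by
      -- The derivative is known almost everywhere for the product law; absolute continuity
      -- transfers this to the joint law.
      refine hac.ae_eq ?_
      conv_lhs => rw [hjoint]
      exact Measure.rnDeriv_withDensity R hd
    filter_upwards [ae_of_ae_map hXYm.aemeasurable h] with ω hω
    rw [llr, hω, ENNReal.toReal_ofReal (div_pos (gaussDensity_pos hσ _) (hp0 _)).le,
      Real.log_div (gaussDensity_pos hσ _).ne' (hp0 _).ne']
    simp [hY]
  have hgfin : ∀ᵐ x : EuclideanSpace ℝ (Fin N), ENNReal.ofReal (gaussDensity N σ x) < ⊤ :=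
    ae_of_all _ fun _ => ENNReal.ofReal_lt_top
  have hpfin : ∀ᵐ x : EuclideanSpace ℝ (Fin N), ENNReal.ofReal (p x) < ⊤ :=
    ae_of_all _ fun _ => ENNReal.ofReal_lt_top
  have hgm : Measurable fun x => Real.log (gaussDensity N σ x) :=
    Real.measurable_log.comp continuous_gaussDensity.measurable
  have hlpm : Measurable fun x => Real.log (p x) := Real.measurable_log.comp hpm
  have hZint : Integrable (fun ω => Real.log (gaussDensity N σ (Z ω))) P := by
    refine (integrable_map_measure (g := fun x => Real.log (gaussDensity N σ x))
      hgm.aestronglyMeasurable hZ.aemeasurable).1 ?_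
    rw [hZlaw, integrable_withDensity_iff_integrable_smul' (by fun_prop) hgfin]
    refine (integrable_gaussDensity_mul_log hN hσ).congr (ae_of_all _ fun x => ?_)
    simp only [ENNReal.toReal_ofReal (gaussDensity_pos hσ x).le, smul_eq_mul]
  have hZval : ∫ ω, Real.log (gaussDensity N σ (Z ω)) ∂P
      = -(N / 2 * (Real.log (2 * Real.pi * σ ^ 2) + 1)) := by
    rw [← integral_map (f := fun x => Real.log (gaussDensity N σ x)) hZ.aemeasurable
      hgm.aestronglyMeasurable, hZlaw,
      integral_withDensity_eq_integral_toReal_smul (by fun_prop) hgfin,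
      ← integral_gaussDensity_mul_log hN hσ]
    refine integral_congr_ae (ae_of_all _ fun x => ?_)
    simp only [ENNReal.toReal_ofReal (gaussDensity_pos hσ x).le, smul_eq_mul]
  have hYint : Integrable (fun ω => Real.log (p (Y ω))) P
      ↔ Integrable fun y => p y * Real.logb 2 (p y) := by
    change Integrable ((fun x => Real.log (p x)) ∘ Y) P ↔ _
    rw [← integrable_map_measure (g := fun x => Real.log (p x)) (f := Y)
      hlpm.aestronglyMeasurable hYm.aemeasurable, hYlaw,
      integrable_withDensity_iff_integrable_smul' (by fun_prop) hpfin]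
    simp_rw [ENNReal.toReal_ofReal (hp0 _).le, smul_eq_mul, mul_logb_eq]
    refine ⟨fun h => h.div_const _, fun h => ?_⟩
    simpa [div_mul_cancel₀ _ hl2.ne'] using h.mul_const (Real.log 2)
  have hYval : ∫ ω, Real.log (p (Y ω)) ∂P
      = Real.log 2 * ∫ y, p y * Real.logb 2 (p y) := by
    rw [← integral_map (f := fun x => Real.log (p x)) (φ := Y) hYm.aemeasurable
      hlpm.aestronglyMeasurable, hYlaw,
      integral_withDensity_eq_integral_toReal_smul (by fun_prop) hpfin, ← integral_const_mul]
    refine integral_congr_ae (ae_of_all _ fun x => ?_)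
    simp only [ENNReal.toReal_ofReal (hp0 x).le, smul_eq_mul, mul_logb_eq]
    field_simp
  have hllrm : StronglyMeasurable (llr J R) := stronglyMeasurable_llr J R
  -- The Gaussian term being integrable, the log-likelihood ratio is integrable exactly when `log
  -- p(Y)` is.
  have hIint : Integrable (llr J R) J ↔ Integrable fun y => p y * Real.logb 2 (p y) := by
    rw [← hYint, integrable_map_measure hllrm.aestronglyMeasurable hXYm.aemeasurable]
    refine ⟨fun h => ?_, fun h => (hZint.sub h).congr (hllr.mono fun ω hω => hω.symm)⟩
    refine (hZint.sub h).congr (hllr.mono fun ω hω => ?_)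
    simp only [Pi.sub_apply, Function.comp_apply, hω]
    ring
  change (((InformationTheory.klDiv J R) / ENNReal.ofReal (Real.log 2) : ℝ≥0∞) : EReal) = _
  by_cases hI : Integrable fun y => p y * Real.logb 2 (p y)
  · have hllrI := hIint.2 hI
    have hkl : InformationTheory.klDiv J R ≠ ⊤ := InformationTheory.klDiv_ne_top hac hllrI
    have hval : (InformationTheory.klDiv J R).toReal
        = -(N / 2 * (Real.log (2 * Real.pi * σ ^ 2) + 1))
          - Real.log 2 * ∫ y, p y * Real.logb 2 (p y) := by
      rw [InformationTheory.toReal_klDiv_of_measure_eq hac (by simp),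
        integral_map hXYm.aemeasurable hllrm.aestronglyMeasurable,
        integral_congr_ae hllr, integral_sub hZint (hYint.2 hI), hZval, hYval]
    rw [← EReal.coe_ennreal_toReal
      (ENNReal.div_ne_top hkl (ENNReal.ofReal_pos.2 hl2).ne'), ENNReal.toReal_div,
      ENNReal.toReal_ofReal hl2.le, hval, extIntegral_eq_integral hI, ← EReal.coe_neg,
      ← EReal.coe_add]
    congr 1
    field_simp
    ring
  -- Here the divergence is `⊤`, and so is the output entropy, because the positive part of `p log₂
  -- p` has finite integral.
  · rw [InformationTheory.klDiv_of_not_integrable (fun h => hI (hIint.1 h)),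
      ENNReal.top_div_of_ne_top ENNReal.ofReal_ne_top, extIntegral_eq_bot
        (f := fun y => p y * Real.logb 2 (p y)) (hpm.mul (hlpm.div_const _)).aestronglyMeasurable
        (lintegral_ofReal_outputDensity_mul_logb_ne_top hN hσ) hI]
    simp

end MutualInformation

end RotInv

end

theorem theorem1 {Ω : Type*} [MeasurableSpace Ω] (P : Measure Ω) [IsProbabilityMeasure P]
    (N : ℕ) (hN : 1 ≤ N) (σ : ℝ) (hσ : 0 < σ)
    (X Z : Ω → EuclideanSpace ℝ (Fin N)) (hX : Measurable X) (hZ : Measurable Z)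
    (hind : IndepFun X Z P)
    (hZlaw : P.map Z = multivariateGaussian 0 (σ ^ 2 • (1 : Matrix (Fin N) (Fin N) ℝ)))
    (hrot : RotInv.RotationallyInvariant (P.map X))
    (fR : ℝ → ℝ)
    (hfR : fR = RotInv.radialMixture N σ (P.map fun ω => ‖X ω‖)) :
    -- the mutual information, as a divergence and as a difference of differential entropies
    ((RotInv.mutualInfo P X (fun ω => X ω + Z ω) : ℝ≥0∞) : EReal) = RotInv.radialRate N fR
    ∧ RotInv.diffEntropy (P.map fun ω => X ω + Z ω) - RotInv.diffEntropy (P.map Z)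
        = RotInv.radialRate N fR
    -- the integral in the formula is well defined, its positive part is finite
    ∧ (∫⁻ r in Ioi (0 : ℝ), ENNReal.ofReal (fR r * Real.logb 2 (fR r / r ^ (N - 1)))) ≠ ⊤
    -- `fR` is the density of the normalized output radius
    ∧ P.map (fun ω => ‖X ω + Z ω‖ / σ)
        = (volume.restrict (Ioi 0)).withDensity (fun r => ENNReal.ofReal (fR r))
    -- if the input radius has a density, the mixture is an integral against that density
    ∧ ∀ f : ℝ → ℝ, Measurable f → (∀ s, 0 ≤ f s) →
        P.map (fun ω => ‖X ω‖)
          = (volume.restrict (Ioi 0)).withDensity (fun s => ENNReal.ofReal (f s)) →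
        ∀ r, fR r = ∫ s in Ioi (0 : ℝ), f s * RotInv.chiDensity N r (s / σ) := by
  have hμ := Measure.isProbabilityMeasure_map (μ := P) hX.aemeasurable
  rw [RotInv.multivariateGaussian_eq_withDensity hN hσ] at hZlaw
  have hYlaw := RotInv.map_output_eq_withDensity hσ hX hZ hind hZlaw
  have hfR' : fR = RotInv.radialMixture N σ ((P.map X).map fun x => ‖x‖) := by
    rw [hfR, Measure.map_map measurable_norm hX]
    rfl
  obtain ⟨hfin, hrate⟩ := hrot.radialRate_eq hN hσ hfR'
  refine ⟨?_, ?_, hfin, ?_, ?_⟩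
  · rw [hrate, RotInv.mutualInfo_eq hN hσ hX hZ hind hZlaw]
  · rw [hrate, hYlaw, hZlaw, RotInv.diffEntropy_withDensity RotInv.measurable_outputDensity
        fun y => (RotInv.outputDensity_pos hσ y).le,
      RotInv.diffEntropy_withDensity (by fun_prop) fun y => (RotInv.gaussDensity_pos hσ y).le,
      RotInv.extIntegral_gaussDensity hN hσ, sub_eq_add_neg, neg_neg]
  · rw [← hrot.map_norm_div_withDensity hN hσ hfR', ← hYlaw,
      Measure.map_map (by fun_prop) (by fun_prop)]
    rfl
  · intro f hf hf0 hlaw r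
    -- This is only a change of measure, hence valid for every real `r`.
    rw [hfR, RotInv.radialMixture, hlaw,
      integral_withDensity_eq_integral_toReal_smul (by fun_prop) (by simp)]
    simp_rw [ENNReal.toReal_ofReal (hf0 _), smul_eq_mul]
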